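/- Let $k$ be a field, let $r \ge 2$, and let $D \subset \mathbb{A}^r = \operatorname{Spec} k[t_1,\dots,t_r]$ be the divisor $\{t_1\cdots t_r = 0\}$ (that is, $D = D_{\underline m}$ with $\underline m = (1,\dots,1)$). Notation. Let $\square = \mathbb{A}^1$ with coordinate $y$ and faces $0$ and $1$, obtained from $\mathbb{P}^1$ by removing $\infty$. For $n \ge 0$, a face of $\square^n$ is a closed subscheme given by some equations $y_i = \epsilon_i$ with $\epsilon_i \in \{0,1\}$. Let $\underline{z}^q(\mathbb{A}^r|D,n)$ be the free abelian group on the integral closed subschemes $V \subset \mathbb{A}^r \times \square^n$ of codimension $q$ that meet $\mathbb{A}^r \times F$ properly for every face $F$ of $\square^n$ and have modulus $D$: on the normalization of the closure of $V$ in $\mathbb{A}^r \times (\mathbb{P}^1)^n$, the pull-back of $D \times (\mathbb{P}^1)^n$ is defined and is $\le$ the pull-back of $\sum_{i=1}^n \mathbb{A}^r \times \{y_i = \infty\}$. Such $V$ are called admissible. Let $\partial = \sum_{i=1}^n (-1)^i(\partial_i^0 - \partial_i^1)$, where $\partial_i^\epsilon$ is the pull-back of cycles to the face $y_i = \epsilon$.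 The group $\mathrm{CH}^q(\mathbb{A}^r|D,n)$ is the $n$-th homology group of the complex $(\underline{z}^q(\mathbb{A}^r|D,\bullet),\partial)$ modulo degenerate cycles (those generated by pull-backs along the projections $\square^n \to \square^{n-1}$ that forget one coordinate). Theorem. $\mathrm{CH}^1(\mathbb{A}^r|D, 0) = 0$. More explicitly, every admissible integral divisor $Z \subset \mathbb{A}^r$ is of the form $Z = V(1 - t_1\cdots t_r\, g)$ for some $g \in k[t_1,\dots,t_r]$ such that $W = V(1 - t_1\cdots t_r\, g\, y_1) \subset \mathbb{A}^r \times \square$ is integral and admissible of codimension $1$ (with modulus $D$) and $\partial [W] = [Z]$. -/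

import Mathlib

/-! Higher Chow groups with modulus of an affine scheme `X = Spec A` with an effective Cartier
divisor `D = {f = 0}`.

The box is taken in the coordinate in which it is the affine line with faces `0` and `1`, and in
which the point removed from the projective line is `∞` (it is related to the coordinate `y` on
`ℙ¹ ∖ {1}`, with faces `∞` and `0`, by the automorphism `y ↦ 1 / (1 - y)` of `ℙ¹`).
So `X × □ⁿ = Spec A[y₁, …, yₙ]`, and an integral closed subscheme of it is a prime ideal. -/

noncomputable section

namespace CycleMod

open MvPolynomial

/-- The integral closed subschemes of `Spec A × □ⁿ`. -/
abbrev IntegralSub (A : Type*) [CommRing A] (n : ℕ) : Type _ :=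
  PrimeSpectrum (MvPolynomial (Fin n) A)

/-- The group of all algebraic cycles on `Spec A × □ⁿ`: the free abelian group on the integral
closed subschemes. -/
abbrev Cyc (A : Type*) [CommRing A] (n : ℕ) : Type _ :=
  IntegralSub A n →₀ ℤ

/-! ### The modulus condition -/

section Modulus

variable {A : Type*} [CommRing A] {n : ℕ}

/-- The coordinate function `yᵢ` in the function field of `V`. -/
def coord (V : IntegralSub A n) (i : Fin n) : V.asIdeal.ResidueField :=
  algebraMap (MvPolynomial (Fin n) A) V.asIdeal.ResidueField (X i)

/-- The coordinate ring of the closure of `V` in `Spec A × (ℙ¹)ⁿ`, in the affine chart with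
coordinates `1 / yᵢ` for `i ∈ S` and `yᵢ` for `i ∉ S`, as a subring of the function field of `V`.
It is to be used only when `yᵢ ≠ 0` on `V` for all `i ∈ S`; otherwise the closure of `V` does not
meet this chart. -/
def closureChart (V : IntegralSub A n) (S : Finset (Fin n)) :
    Subalgebra A V.asIdeal.ResidueField :=
  Algebra.adjoin A
    ({x | ∃ i ∈ S, x = (coord V i)⁻¹} ∪ {x | ∃ i ∉ S, x = coord V i})

/-- `V` has modulus `D = {f = 0}` relative to the divisor `F = ∑ᵢ {yᵢ = ∞}` of `(ℙ¹)ⁿ`: on the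
normalization of the closure of `V` in `Spec A × (ℙ¹)ⁿ`, the pull-back of `D × (ℙ¹)ⁿ` is defined
(that is, `f` is not zero on `V`), and it is `≤` the pull-back of `Spec A × F`. In the chart given
by `S`, the divisor `F` has the equation `∏_{i ∈ S} 1 / yᵢ`, and the inequality says that the
quotient of the two local equations is regular on the normalization, that is, integral over the
coordinate ring of the closure. -/
def HasModulus (f : A) (V : IntegralSub A n) : Prop :=
  algebraMap A V.asIdeal.ResidueField f ≠ 0 ∧
    ∀ S : Finset (Fin n), (∀ i ∈ S, coord V i ≠ 0) →
      IsIntegral (closureChart V S)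
        ((∏ i ∈ S, (coord V i)⁻¹) / algebraMap A V.asIdeal.ResidueField f)

/-! ### The face condition and admissible cycles -/

/-- The ideal of `Spec A × G`, for the face `G = {yᵢ = εᵢ for i ∈ I}` of `□ⁿ`. -/
def faceIdeal (I : Finset (Fin n)) (ε : Fin n → A) : Ideal (MvPolynomial (Fin n) A) :=
  Ideal.span ((fun i => X i - C (ε i)) '' (I : Set (Fin n)))

/-- `V` intersects `Spec A × G` properly for each face `G` of `□ⁿ`: the intersection is empty or of
dimension `≤ dim V - codim G`. (The Krull dimension of the zero ring is `⊥`.) -/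
def MeetsFacesProperly (V : IntegralSub A n) : Prop :=
  ∀ (I : Finset (Fin n)) (ε : Fin n → A), (∀ i, ε i = 0 ∨ ε i = 1) →
    ringKrullDim (MvPolynomial (Fin n) A ⧸ (V.asIdeal ⊔ faceIdeal I ε)) + (I.card : ℕ) ≤
      ringKrullDim (MvPolynomial (Fin n) A ⧸ V.asIdeal)

/-- The integral closed subschemes that generate the group of admissible cycles with modulus
`{f = 0}` of codimension `q` on `Spec A × □ⁿ`. The first condition is
`dim V = dim A - q + n`; the ring `A` is meant to be equidimensional and of finite type over a
field. -/
structure Admissible (f : A) (q : ℕ) (V : IntegralSub A n) : Prop where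
  dim_eq : ringKrullDim (MvPolynomial (Fin n) A ⧸ V.asIdeal) + (q : ℕ) = ringKrullDim A + (n : ℕ)
  face : MeetsFacesProperly V
  modulus : HasModulus f V

end Modulus

section Complex

variable {A : Type*} [CommRing A]

/-- The group `z^q(X|D, n)` of admissible cycles with modulus `D = {f = 0}` on `X = Spec A`, before
dividing by the degenerate cycles: the free abelian group on the admissible `V`. -/
def admissibleCycles (f : A) (q n : ℕ) : AddSubgroup (Cyc A n) :=
  (Finsupp.supported ℤ ℤ {V : IntegralSub A n | Admissible f q V}).toAddSubgroup

/-- The degenerate admissible cycles: the subgroup generated by the pull-backs `V × □` of the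
admissible `V` along the projections `□ⁿ⁺¹ → □ⁿ` that forget one coordinate. -/
def degenerateCycles (f : A) (q : ℕ) : (n : ℕ) → AddSubgroup (Cyc A n)
  | 0 => ⊥
  | n + 1 => AddSubgroup.closure
      {c | ∃ (i : Fin (n + 1)) (V : IntegralSub A n) (W : IntegralSub A (n + 1)),
        Admissible f q V ∧
        W.asIdeal = V.asIdeal.map (rename (R := A) i.succAbove) ∧
        c = Finsupp.single W 1}

/-! ### Boundary maps -/

open Classical in
/-- The multiplicity of `Q` in the cycle of the closed subscheme `Spec R/J`: the length of the local
ring of the subscheme at `Q` if `Q` is (the generic point of) an irreducible component, and `0`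
otherwise. -/
def multiplicity {R : Type*} [CommRing R] (J : Ideal R) (Q : PrimeSpectrum R) : ℤ :=
  if Q.asIdeal ∈ J.minimalPrimes then
    ((Module.length (Localization.AtPrime Q.asIdeal)
      (Localization.AtPrime Q.asIdeal ⧸
        J.map (algebraMap R (Localization.AtPrime Q.asIdeal)))).toNat : ℤ)
  else 0

theorem multiplicity_support_finite {R : Type*} [CommRing R] [IsNoetherianRing R] (J : Ideal R) :
    (Function.support (multiplicity J)).Finite := by
  have h : (PrimeSpectrum.asIdeal ⁻¹' J.minimalPrimes : Set (PrimeSpectrum R)).Finite :=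
    Set.Finite.preimage (fun a _ b _ hab => PrimeSpectrum.ext hab)
      (Ideal.finite_minimalPrimes_of_isNoetherianRing R J)
  refine h.subset fun Q hQ => ?_
  by_contra hc
  exact hQ (if_neg hc)

/-- The cycle associated to the closed subscheme `Spec R/J` of `Spec R`. -/
def cycleOf {R : Type*} [CommRing R] [IsNoetherianRing R] (J : Ideal R) : PrimeSpectrum R →₀ ℤ :=
  Finsupp.ofSupportFinite (multiplicity J) (multiplicity_support_finite J)

/-- The restriction of functions to the face `{yᵢ = ε}`, identified with `Spec A × □ⁿ` by the
remaining coordinates in their order. -/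
def restrictFace {n : ℕ} (i : Fin (n + 1)) (ε : A) :
    MvPolynomial (Fin (n + 1)) A →ₐ[A] MvPolynomial (Fin n) A :=
  aeval (i.insertNth (C ε) X : Fin (n + 1) → MvPolynomial (Fin n) A)

variable [IsNoetherianRing A]

/-- The pull-back of cycles to the face `{yᵢ = ε}`: an integral `V` goes to the cycle of its
scheme-theoretic intersection with the face. (It is meaningful for those `V` that are not contained
in the face; admissible ones are not.) -/
def facePullback {n : ℕ} (i : Fin (n + 1)) (ε : A) : Cyc A (n + 1) →+ Cyc A n :=
  (Finsupp.linearCombination ℤ fun V : IntegralSub A (n + 1) =>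
    (cycleOf (V.asIdeal.map (restrictFace i ε)) : Cyc A n)).toAddMonoidHom

/-- The boundary `∂ = ∑ᵢ (-1)ⁱ (∂ᵢ⁰ - ∂ᵢ¹)`, with `i = 1, …, n + 1`. -/
def boundary (A : Type*) [CommRing A] [IsNoetherianRing A] (n : ℕ) : Cyc A (n + 1) →+ Cyc A n :=
  ∑ i : Fin (n + 1),
    ((-1 : ℤ) ^ ((i : ℕ) + 1)) • (facePullback i (0 : A) - facePullback i (1 : A))

/-! ### Higher Chow groups with modulus -/

/-- The admissible cycles in degree `n` whose boundary is degenerate. Modulo degenerate cycles they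
are the kernel of the differential. -/
def closedCycles (f : A) (q : ℕ) : (n : ℕ) → AddSubgroup (Cyc A n)
  | 0 => admissibleCycles f q 0
  | n + 1 => admissibleCycles f q (n + 1) ⊓ (degenerateCycles f q n).comap (boundary A n)

/-- The boundaries of admissible cycles, plus the degenerate cycles. -/
def boundaryCycles (f : A) (q n : ℕ) : AddSubgroup (Cyc A n) :=
  (admissibleCycles f q (n + 1)).map (boundary A n) ⊔ degenerateCycles f q n

/-- The higher Chow group `CH^q(X|D, n)` with modulus, of `X = Spec A` with `D = {f = 0}`: the
homology in degree `n` of the complex of admissible cycles modulo degenerate ones. -/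
abbrev HigherChow (f : A) (q n : ℕ) : Type _ :=
  closedCycles f q n ⧸ (boundaryCycles f q n).addSubgroupOf (closedCycles f q n)

end Complex

/-- The equation `t₁^m₁ ⋯ t_r^m_r` of the divisor `D_m` of the affine space `𝔸^r`. -/
def modulusEq (k : Type*) [Field k] {r : ℕ} (m : Fin r → ℕ) : MvPolynomial (Fin r) k :=
  ∏ i, X i ^ m i

end CycleMod

end

/-!
Write `A = k[t₁, …, t_r]` and `f = t₁ ⋯ t_r`. An admissible integral divisor `Z` is a prime of
codimension one in a factorial ring, hence `Z = V(p)` with `p` prime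
(`exists_prime_eq_span_of_ringKrullDim`). In degree zero there is no divisor at infinity, so the
modulus condition says that `1 / f` is integral over `A / p`; this ring contains `f`, so `f` is a
unit in it and `p q + f h = 1` for some `q` and `h` (`HasModulus.exists_one_sub_mem`). On each
hyperplane `tᵢ = 0` the polynomial `p` is then a unit, that is, a nonzero constant; evaluation at
the origin, which lies on all the hyperplanes, shows that these constants are all equal to `p(0)`.
Therefore every `tᵢ`, and so their product, divides `p - p(0)`, and after scaling `p = 1 - f g`
(`exists_eq_C_mul_one_sub`).

The divisor `W = V(1 - f g y)` is the graph of `1 / (f g)`, with coordinate ring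
`A[1 / (f g)]`; in particular it is integral (`prime_one_sub_C_mul_X`). It does not meet `y = 0`,
and it meets `y = 1` in exactly `Z`, which gives the boundary
(`boundary_single_of_asIdeal_eq`). Its modulus condition holds because `1 / f = g y` on `W`, so that
`1 / f` is regular where `y` is, and `(1 / y) / f = g` is regular in the chart at `y = ∞`
(`hasModulus_of_asIdeal_eq`). For its dimension, the bound from above is that for a hypersurface in
`Spec A × □`, and the bound from below comes from the known dimension of `Z`, the zero locus of the
nonzero function `1 - f g` on `W` (`ringKrullDim_quotient_of_asIdeal_eq`).
-/

namespace CycleMod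

open MvPolynomial nonZeroDivisors

/-! ### Primes of codimension one -/

/-- In a factorial ring of finite dimension, primes of codimension one (as measured by the dimension
of the quotient) are principal. -/
theorem exists_prime_eq_span_of_ringKrullDim {R : Type*} [CommRing R] [IsDomain R]
    [UniqueFactorizationMonoid R] {d : ℕ} (hd : ringKrullDim R = d) {P : Ideal R} [P.IsPrime]
    (hP : ringKrullDim (R ⧸ P) + 1 = ringKrullDim R) : ∃ p, Prime p ∧ P = Ideal.span {p} := by
  have hbot : P ≠ ⊥ := by
    rintro rfl
    rw [(RingEquiv.quotientBot R).ringKrullDim, hd] at hP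
    norm_cast at hP
    omega
  obtain ⟨p, hpP, hp⟩ := Ideal.IsPrime.exists_mem_prime_of_ne_bot ‹P.IsPrime› hbot
  refine ⟨p, hp, le_antisymm ?_ ((Ideal.span_singleton_le_iff_mem _).2 hpP)⟩
  intro x hx
  by_contra hxp
  have := (Ideal.span_singleton_prime hp.ne_zero).2 hp
  have h₁ := ringKrullDim_quotient_succ_le_of_nonZeroDivisor
    (mem_nonZeroDivisors_of_ne_zero hp.ne_zero)
  -- A further element of `P` outside `(p)` would drop the dimension a second time.
  have h₂ := ringKrullDim_succ_le_of_surjective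
    (Ideal.Quotient.factor ((Ideal.span_singleton_le_iff_mem _).2 hpP))
    (Ideal.Quotient.factor_surjective _)
    (mem_nonZeroDivisors_of_ne_zero (mt Ideal.Quotient.eq_zero_iff_mem.1 hxp))
    (by simpa [Ideal.Quotient.eq_zero_iff_mem] using hx)
  have h₃ := (add_le_add_left h₂ 1).trans h₁
  rw [hP, hd] at h₃
  norm_cast at h₃
  omega

/-! ### Units modulo the coordinate hyperplanes -/

/-- If the hypersurface `p = 0` is disjoint from the coordinate hyperplanes, then `p` is constant on
each of them, with the value that it has at the origin. -/
theorem exists_eq_C_mul_one_sub {k : Type*} [Field k] {r : ℕ} (hr : 0 < r)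
    {p q h : MvPolynomial (Fin r) k} (hpq : p * q + (∏ i, X i) * h = 1) :
    ∃ (c : k) (g : MvPolynomial (Fin r) k), c ≠ 0 ∧ p = C c * (1 - (∏ i, X i) * g) := by
  have key : ∀ i : Fin r, X i ∣ p - C (constantCoeff p) ∧ constantCoeff p ≠ 0 := by
    intro i
    -- Restriction to the hyperplane `tᵢ = 0`.
    set φ : MvPolynomial (Fin r) k →ₐ[k] MvPolynomial (Fin r) k :=
      aeval (Function.update X i 0) with hφ
    have hφi : φ (X i) = 0 := by simp [hφ]
    have hdvd : ∀ x, X i ∣ x - φ x := by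
      intro x
      have : (Ideal.Quotient.mkₐ k (Ideal.span {(X i : MvPolynomial (Fin r) k)})).comp φ =
          Ideal.Quotient.mkₐ k (Ideal.span {(X i : MvPolynomial (Fin r) k)}) := by
        ext j
        by_cases hj : j = i
        · subst hj
          simp [hφ]
        · simp [hφ, hj]
      rw [← Ideal.mem_span_singleton, ← Ideal.Quotient.mk_eq_mk_iff_sub_mem]
      exact (DFunLike.congr_fun this x).symm
    have hu : φ p * φ q = 1 := by
      have := congrArg φ hpq
      rw [map_add, map_mul, map_mul, map_prod, Finset.prod_eq_zero (Finset.mem_univ i) hφi] at this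
      simpa using this
    obtain ⟨c, hc, hpc⟩ := isUnit_iff_eq_C_of_isReduced.1 (IsUnit.of_mul_eq_one _ hu)
    have h0 : constantCoeff p = c := by
      obtain ⟨y, hy⟩ := hdvd p
      have := congrArg constantCoeff hy
      rw [hpc] at this
      simpa [sub_eq_zero] using this
    rw [h0, ← hpc]
    exact ⟨hdvd p, hc.ne_zero⟩
  have hc := (key ⟨0, hr⟩).2
  obtain ⟨y, hy⟩ : ∏ i, X i ∣ p - C (constantCoeff p) := by
    refine Finset.prod_dvd_of_isRelPrime (fun i _ j _ hij => ?_) fun i _ => (key i).1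
    refine (X_prime.irreducible.isRelPrime_iff_not_dvd).2 fun hd => hij ?_
    simpa [X_dvd_X] using hd
  refine ⟨constantCoeff p, -(C (constantCoeff p)⁻¹ * y), hc, ?_⟩
  have hcc : (C (constantCoeff p) : MvPolynomial (Fin r) k) * C (constantCoeff p)⁻¹ = 1 := by
    rw [← C_mul, mul_inv_cancel₀ hc, C_1]
  linear_combination hy + (-(∏ i, X i) * y) * hcc

/-! ### Cycles of prime ideals -/

theorem cycleOf_top {R : Type*} [CommRing R] [IsNoetherianRing R] :
    cycleOf (⊤ : Ideal R) = 0 := by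
  ext Q
  change multiplicity ⊤ Q = 0
  exact if_neg (by simp [Ideal.minimalPrimes_top])

theorem cycleOf_asIdeal {R : Type*} [CommRing R] [IsNoetherianRing R] (P : PrimeSpectrum R) :
    cycleOf P.asIdeal = Finsupp.single P 1 := by
  ext Q
  change multiplicity P.asIdeal Q = _
  have hmem : Q.asIdeal ∈ P.asIdeal.minimalPrimes ↔ Q = P := by
    rw [Ideal.minimalPrimes_eq_subsingleton_self, Set.mem_singleton_iff, PrimeSpectrum.ext_iff]
  by_cases h : Q = P
  · subst h
    have : IsSimpleModule (Localization.AtPrime Q.asIdeal)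
        (Localization.AtPrime Q.asIdeal ⧸ Q.asIdeal.map
          (algebraMap R (Localization.AtPrime Q.asIdeal))) := by
      rw [Localization.AtPrime.map_eq_maximalIdeal, isSimpleModule_iff_isCoatom,
        ← Ideal.isMaximal_def]
      infer_instance
    rw [multiplicity, if_pos (hmem.2 rfl), Module.length_eq_one]
    simp
  · rw [multiplicity, if_neg (mt hmem.1 h), Finsupp.single_eq_of_ne h]

/-! ### The modulus condition -/

theorem isUnit_of_isIntegral_inv {R K : Type*} [CommRing R] [Field K] [Algebra R K]
    [FaithfulSMul R K] {x : R} (hx : algebraMap R K x ≠ 0)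
    (h : IsIntegral R (algebraMap R K x)⁻¹) : IsUnit x := by
  let S := Algebra.adjoin R {(algebraMap R K x)⁻¹}
  have : Algebra.IsIntegral R S := Algebra.IsIntegral.adjoin (by simpa using h)
  have : FaithfulSMul R S := (faithfulSMul_iff_algebraMap_injective R S).2
    fun a b hab => FaithfulSMul.algebraMap_injective R K (congrArg Subtype.val hab)
  have : IsLocalHom (algebraMap R S) := Algebra.IsIntegral.isLocalHom R S
  refine isUnit_of_map_unit (algebraMap R S) x ?_
  refine IsUnit.of_mul_eq_one ⟨(algebraMap R K x)⁻¹, Algebra.subset_adjoin rfl⟩ ?_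
  exact Subtype.ext (mul_inv_cancel₀ hx)

/-- An integral closed subscheme of `Spec A` that has modulus `{f = 0}` is disjoint from
`{f = 0}`. -/
theorem HasModulus.exists_one_sub_mem {A : Type*} [CommRing A] {f : A} {Z : IntegralSub A 0}
    (h : HasModulus f Z) : ∃ a : A, C (1 - f * a) ∈ Z.asIdeal := by
  obtain ⟨hf, hint⟩ := h
  have hint := hint ∅ (by simp)
  rw [Finset.prod_empty, one_div] at hint
  obtain ⟨y, hy⟩ := isUnit_iff_exists_inv.1 (isUnit_of_isIntegral_inv
    (R := closureChart Z ∅) (x := algebraMap A _ f) hf hint)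
  obtain ⟨a, ha⟩ : (y : Z.asIdeal.ResidueField) ∈ (⊥ : Subalgebra A Z.asIdeal.ResidueField) := by
    convert y.2
    simp [closureChart]
  refine ⟨a, ?_⟩
  rw [← Ideal.algebraMap_residueField_eq_zero, ← MvPolynomial.algebraMap_eq,
    ← IsScalarTower.algebraMap_apply, map_sub, map_mul, map_one, sub_eq_zero, eq_comm]
  have hay : algebraMap A Z.asIdeal.ResidueField a = y := ha
  rw [hay]
  exact congrArg Subtype.val hy

/-! ### The graph of `1 / h` -/

/-- The quotient by `1 - h y` is the localization `A[1 / h]`, a domain. -/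
theorem prime_one_sub_C_mul_X {A : Type*} [CommRing A] [IsDomain A] {h : A} (hh : h ≠ 0) :
    Prime (1 - C h * X 0 : MvPolynomial (Fin 1) A) := by
  have hu : Prime (C h * X () - 1 : MvPolynomial Unit A) := by
    have hne : (C h * X () - 1 : MvPolynomial Unit A) ≠ 0 := by
      intro h0
      simpa using congrArg constantCoeff h0
    rw [← Ideal.span_singleton_prime hne, ← Ideal.Quotient.isDomain_iff_prime]
    have : IsDomain (Localization.Away h) := IsLocalization.isDomain_localization
      (Submonoid.powers_le.2 (mem_nonZeroDivisors_of_ne_zero hh))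
    exact (IsLocalization.Away.mvPolynomialQuotientEquiv
      (Localization.Away h) h).toMulEquiv.isDomain _
  rw [← MulEquiv.prime_iff (renameEquiv A (Equiv.ofUnique Unit (Fin 1)))] at hu
  have := hu.neg
  simpa using this

/-- The function `1 - h` does not vanish identically on `V(1 - h y)`, as one sees at the generic
point `y = 1 / h`. -/
theorem C_one_sub_notMem_span {A : Type*} [CommRing A] [IsDomain A] {h : A} (h0 : h ≠ 0)
    (h1 : h ≠ 1) :
    C (1 - h) ∉ Ideal.span {(1 - C h * X 0 : MvPolynomial (Fin 1) A)} := by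
  intro hmem
  let K := FractionRing A
  have hK : algebraMap A K h ≠ 0 := by simpa using h0
  obtain ⟨q, hq⟩ := Ideal.mem_span_singleton.1 hmem
  have := congrArg (aeval fun _ : Fin 1 => (algebraMap A K h)⁻¹) hq
  rw [aeval_C, map_mul, map_sub (aeval _), map_mul, map_one, aeval_C, aeval_X, mul_inv_cancel₀ hK,
    sub_self, zero_mul, FaithfulSMul.algebraMap_eq_zero_iff, sub_eq_zero] at this
  exact h1 this.symm

/-! ### The faces, the modulus and the dimension of the graph -/

theorem map_restrictFace_zero {A : Type*} [CommRing A] (h : A) :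
    (Ideal.span {(1 - C h * X 0 : MvPolynomial (Fin 1) A)}).map (restrictFace 0 (0 : A)) = ⊤ := by
  simp [Ideal.map_span, restrictFace]

theorem map_restrictFace_one {A : Type*} [CommRing A] (h : A) :
    (Ideal.span {(1 - C h * X 0 : MvPolynomial (Fin 1) A)}).map (restrictFace 0 (1 : A)) =
      Ideal.span {C (1 - h)} := by
  simp [Ideal.map_span, restrictFace]

theorem hasModulus_of_asIdeal_eq {A : Type*} [CommRing A] {f g : A} {W : IntegralSub A 1}
    (hW : W.asIdeal = Ideal.span {1 - C (f * g) * X 0}) : HasModulus f W := by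
  have hrel : algebraMap A W.asIdeal.ResidueField f *
      (algebraMap A W.asIdeal.ResidueField g * coord W 0) = 1 := by
    have hmem : (1 - C (f * g) * X 0 : MvPolynomial (Fin 1) A) ∈ W.asIdeal :=
      hW ▸ Ideal.mem_span_singleton_self _
    rw [← Ideal.algebraMap_residueField_eq_zero, map_sub, map_mul, map_one, sub_eq_zero,
      ← MvPolynomial.algebraMap_eq, ← IsScalarTower.algebraMap_apply, map_mul] at hmem
    rw [hmem, coord, mul_assoc]
  have hf := left_ne_zero_of_mul_eq_one hrel
  have hinv := eq_inv_of_mul_eq_one_right hrel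
  refine ⟨hf, fun S hS => ?_⟩
  suffices hmem : (∏ i ∈ S, (coord W i)⁻¹) / algebraMap A W.asIdeal.ResidueField f ∈
      closureChart W S from isIntegral_algebraMap (x := (⟨_, hmem⟩ : closureChart W S))
  rw [div_eq_mul_inv, ← hinv]
  by_cases h0 : (0 : Fin 1) ∈ S
  · have hS1 : S = {0} := by
      ext i
      simp [Subsingleton.elim i 0, h0]
    rw [hS1, Finset.prod_singleton, mul_left_comm, inv_mul_cancel₀ (hS 0 h0), mul_one]
    exact Subalgebra.algebraMap_mem _ g
  · have hS1 : S = ∅ := by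
      ext i
      simp [Subsingleton.elim i 0, h0]
    rw [hS1, Finset.prod_empty, one_mul]
    exact mul_mem (Subalgebra.algebraMap_mem _ g)
      (Algebra.subset_adjoin (Or.inr ⟨0, by simp, rfl⟩))

theorem meetsFacesProperly_of_asIdeal_eq {A : Type*} [CommRing A] [IsDomain A] {h : A}
    (h0 : h ≠ 0) (h1 : h ≠ 1) {W : IntegralSub A 1}
    (hW : W.asIdeal = Ideal.span {1 - C h * X 0}) : MeetsFacesProperly W := by
  intro I ε hε
  have hrel : (1 - C h * X 0 : MvPolynomial (Fin 1) A) ∈ W.asIdeal :=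
    hW ▸ Ideal.mem_span_singleton_self _
  by_cases hI : (0 : Fin 1) ∈ I
  · have hI1 : I = {0} := by
      ext i
      simp [Subsingleton.elim i 0, hI]
    subst hI1
    have hface : X 0 - C (ε 0) ∈ W.asIdeal ⊔ faceIdeal {0} ε :=
      Ideal.mem_sup_right (Ideal.subset_span ⟨0, by simp, rfl⟩)
    rcases hε 0 with hε0 | hε0
    · have htop : W.asIdeal ⊔ faceIdeal {0} ε = ⊤ := by
        rw [Ideal.eq_top_iff_one]
        rw [hε0, C_0, sub_zero] at hface
        simpa using add_mem (Ideal.mem_sup_left hrel) (Ideal.mul_mem_left _ (C h) hface)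
      have : Subsingleton (MvPolynomial (Fin 1) A ⧸ (W.asIdeal ⊔ faceIdeal {0} ε)) :=
        Ideal.Quotient.subsingleton_iff.2 htop
      rw [ringKrullDim_eq_bot_of_subsingleton, WithBot.bot_add]
      exact bot_le
    · rw [Finset.card_singleton, Nat.cast_one]
      rw [hε0, C_1] at hface
      refine ringKrullDim_succ_le_of_surjective (r := Ideal.Quotient.mk W.asIdeal (X 0 - 1))
        (Ideal.Quotient.factor le_sup_left)
        (Ideal.Quotient.factor_surjective _) (mem_nonZeroDivisors_of_ne_zero fun hzero => ?_)
        (by simpa only [Ideal.Quotient.factor_mk, Ideal.Quotient.eq_zero_iff_mem] using hface)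
      -- Modulo `1 - h y`, the function `h (y - 1)` is the nonzero constant `1 - h`.
      refine C_one_sub_notMem_span h0 h1 (hW ▸ ?_ : C (1 - h) ∈ _)
      have := add_mem hrel (Ideal.mul_mem_left _ (C h) (Ideal.Quotient.eq_zero_iff_mem.1 hzero))
      convert this using 1
      rw [C_sub, C_1]
      ring
  · have hI1 : I = ∅ := by
      ext i
      simp [Subsingleton.elim i 0, hI]
    subst hI1
    rw [faceIdeal, Finset.coe_empty, Set.image_empty, Ideal.span_empty, sup_bot_eq]
    simp

theorem ringKrullDim_quotient_of_asIdeal_eq {A : Type*} [CommRing A] [IsDomain A]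
    [IsNoetherianRing A] {h : A} (h0 : h ≠ 0) (h1 : h ≠ 1) {Z : IntegralSub A 0}
    {W : IntegralSub A 1} (hZ : Z.asIdeal = Ideal.span {C (1 - h)})
    (hW : W.asIdeal = Ideal.span {1 - C h * X 0})
    (hdim : ringKrullDim (MvPolynomial (Fin 0) A ⧸ Z.asIdeal) + 1 = ringKrullDim A) :
    ringKrullDim (MvPolynomial (Fin 1) A ⧸ W.asIdeal) + 1 = ringKrullDim A + 1 := by
  apply le_antisymm
  · have := ringKrullDim_quotient_succ_le_of_nonZeroDivisor
      (mem_nonZeroDivisors_of_ne_zero (prime_one_sub_C_mul_X h0).ne_zero)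
    rw [← hW, MvPolynomial.ringKrullDim_of_isNoetherianRing (R := A)] at this
    simpa using this
  · gcongr
    rw [← hdim]
    have hker : ∀ x ∈ W.asIdeal, (Ideal.Quotient.mk Z.asIdeal).comp
        (restrictFace (0 : Fin 1) (1 : A)).toRingHom x = 0 := by
      intro x hx
      refine Ideal.Quotient.eq_zero_iff_mem.2 ?_
      rw [hZ, ← map_restrictFace_one, ← hW]
      exact Ideal.mem_map_of_mem _ hx
    refine ringKrullDim_succ_le_of_surjective (r := Ideal.Quotient.mk W.asIdeal (C (1 - h)))
      (Ideal.Quotient.lift W.asIdeal _ hker)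
      (Ideal.Quotient.lift_surjective_of_surjective _ hker ?_)
      (mem_nonZeroDivisors_of_ne_zero
        (mt Ideal.Quotient.eq_zero_iff_mem.1 (hW ▸ C_one_sub_notMem_span h0 h1))) ?_
    · refine Ideal.Quotient.mk_surjective.comp fun y => ?_
      obtain ⟨a, rfl⟩ := C_surjective (Fin 0) y
      exact ⟨C a, by simp [restrictFace]⟩
    · rw [Ideal.Quotient.lift_mk, RingHom.comp_apply, Ideal.Quotient.eq_zero_iff_mem, hZ]
      refine Ideal.subset_span ?_
      simp [restrictFace]

theorem boundary_single_of_asIdeal_eq {A : Type*} [CommRing A] [IsNoetherianRing A] {h : A}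
    {Z : IntegralSub A 0} {W : IntegralSub A 1} (hZ : Z.asIdeal = Ideal.span {C (1 - h)})
    (hW : W.asIdeal = Ideal.span {1 - C h * X 0}) :
    boundary A 0 (Finsupp.single W 1) = Finsupp.single Z 1 := by
  have h₀ : facePullback (0 : Fin 1) (0 : A) (Finsupp.single W 1) = 0 := by
    simp [facePullback, hW, map_restrictFace_zero, cycleOf_top]
  have h₁ : facePullback (0 : Fin 1) (1 : A) (Finsupp.single W 1) = Finsupp.single Z 1 := by
    rw [← cycleOf_asIdeal Z, hZ, ← map_restrictFace_one, ← hW]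
    simp [facePullback]
  simp [boundary, h₀, h₁]

theorem exists_admissible_boundary_eq {A : Type*} [CommRing A] [IsDomain A] [IsNoetherianRing A]
    {d : ℕ} (hd : ringKrullDim A = d) {f g : A} {Z : IntegralSub A 0} (hZ : Admissible f 1 Z)
    (hZg : Z.asIdeal = Ideal.span {C (1 - f * g)}) :
    ∃ W : IntegralSub A 1, W.asIdeal = Ideal.span {1 - C (f * g) * X 0} ∧
      Admissible f 1 W ∧ boundary A 0 (Finsupp.single W 1) = Finsupp.single Z 1 := by
  have hdim : ringKrullDim (MvPolynomial (Fin 0) A ⧸ Z.asIdeal) + 1 = ringKrullDim A := by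
    simpa using hZ.dim_eq
  have h0 : f * g ≠ 0 := fun h => Z.isPrime.ne_top (by simp [hZg, h])
  have h1 : f * g ≠ 1 := by
    intro h
    have hbot : Z.asIdeal = ⊥ := by simp [hZg, h]
    have heq := ((Ideal.quotEquivOfEq hbot).trans (RingEquiv.quotientBot _)).ringKrullDim
    rw [heq, ringKrullDim_mvPolynomial_of_isEmpty, hd] at hdim
    norm_cast at hdim
    omega
  have hp := prime_one_sub_C_mul_X h0
  obtain ⟨W, hW⟩ : ∃ W : IntegralSub A 1, W.asIdeal = Ideal.span {1 - C (f * g) * X 0} :=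
    ⟨⟨_, (Ideal.span_singleton_prime hp.ne_zero).2 hp⟩, rfl⟩
  have hWdim : ringKrullDim (MvPolynomial (Fin 1) A ⧸ W.asIdeal) + (1 : ℕ) =
      ringKrullDim A + (1 : ℕ) := by
    rw [Nat.cast_one]
    exact ringKrullDim_quotient_of_asIdeal_eq h0 h1 hZg hW hdim
  exact ⟨W, hW, ⟨hWdim, meetsFacesProperly_of_asIdeal_eq h0 h1 hW, hasModulus_of_asIdeal_eq hW⟩,
    boundary_single_of_asIdeal_eq hZg hW⟩

/-! ### Admissible divisors of affine space -/

theorem ringKrullDim_mvPolynomial_fin (k : Type*) [Field k] (r : ℕ) :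
    ringKrullDim (MvPolynomial (Fin r) k) = r := by
  rw [MvPolynomial.ringKrullDim_of_isNoetherianRing]
  simp

theorem Admissible.exists_asIdeal_eq {k : Type*} [Field k] {r : ℕ} (hr : 0 < r)
    {Z : IntegralSub (MvPolynomial (Fin r) k) 0}
    (hZ : Admissible (∏ i, X i : MvPolynomial (Fin r) k) 1 Z) :
    ∃ g : MvPolynomial (Fin r) k, Z.asIdeal = Ideal.span {C (1 - (∏ i, X i) * g)} := by
  have hd := ringKrullDim_mvPolynomial_fin k r
  have hd₀ := ringKrullDim_mvPolynomial_of_isEmpty (R := MvPolynomial (Fin r) k) (Fin 0)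
  obtain ⟨p, -, hp⟩ := exists_prime_eq_span_of_ringKrullDim (hd₀.trans hd) (P := Z.asIdeal)
    (by simpa [hd₀] using hZ.dim_eq)
  obtain ⟨p, rfl⟩ := C_surjective (Fin 0) p
  obtain ⟨h, hh⟩ := hZ.modulus.exists_one_sub_mem
  rw [hp] at hh
  obtain ⟨q, hq⟩ := Ideal.mem_span_singleton.1 hh
  obtain ⟨q, rfl⟩ := C_surjective (Fin 0) q
  rw [← C_mul] at hq
  have hpq : p * q + (∏ i, X i) * h = 1 := by
    rw [← C_injective _ _ hq]
    ring
  obtain ⟨c, g, hc, rfl⟩ := exists_eq_C_mul_one_sub hr hpq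
  refine ⟨g, ?_⟩
  rw [hp, C_mul, mul_comm]
  exact Ideal.span_singleton_mul_right_unit ((hc.isUnit.map C).map C) _

/-! ### The Chow group in degree zero -/

theorem subsingleton_higherChow_zero {A : Type*} [CommRing A] [IsNoetherianRing A] {f : A} {q : ℕ}
    (h : ∀ Z : IntegralSub A 0, Admissible f q Z → ∃ W : IntegralSub A 1,
      Admissible f q W ∧ boundary A 0 (Finsupp.single W 1) = Finsupp.single Z 1) :
    Subsingleton (HigherChow f q 0) := by
  rw [QuotientAddGroup.subsingleton_iff, AddSubgroup.addSubgroupOf_eq_top]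
  intro c hc
  have hc : c ∈ Finsupp.supported ℤ ℤ {V : IntegralSub A 0 | Admissible f q V} := hc
  refine AddSubgroup.mem_sup_left ?_
  rw [← Finsupp.sum_single c]
  refine AddSubgroup.sum_mem _ fun Z hZ => ?_
  obtain ⟨W, hW, hWZ⟩ := h Z ((Finsupp.mem_supported _ _).1 hc hZ)
  refine ⟨c Z • Finsupp.single W 1, AddSubgroup.zsmul_mem _ ?_ _, ?_⟩
  · exact Finsupp.single_mem_supported ℤ _ hW
  · rw [map_zsmul, hWZ]
    simp

end CycleMod

theorem theorem5p14 (k : Type*) [Field k] (r : ℕ) (hr : 2 ≤ r) :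
    Subsingleton (CycleMod.HigherChow (CycleMod.modulusEq k (fun _ : Fin r => 1)) 1 0) ∧
    ∀ Z : CycleMod.IntegralSub (MvPolynomial (Fin r) k) 0,
      CycleMod.Admissible (CycleMod.modulusEq k (fun _ : Fin r => 1)) 1 Z →
      ∃ g : MvPolynomial (Fin r) k,
        Z.asIdeal = Ideal.span {MvPolynomial.C (1 - (∏ i, MvPolynomial.X i) * g)} ∧
        ∃ W : CycleMod.IntegralSub (MvPolynomial (Fin r) k) 1,
          W.asIdeal = Ideal.span
            {1 - MvPolynomial.C ((∏ i, MvPolynomial.X i) * g) * MvPolynomial.X 0} ∧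
          CycleMod.Admissible (CycleMod.modulusEq k (fun _ : Fin r => 1)) 1 W ∧
          CycleMod.boundary (MvPolynomial (Fin r) k) 0 (Finsupp.single W 1) =
            Finsupp.single Z 1 := by
  have hf : CycleMod.modulusEq k (fun _ : Fin r => 1) = ∏ i, MvPolynomial.X i := by
    simp [CycleMod.modulusEq]
  rw [hf]
  have hd := CycleMod.ringKrullDim_mvPolynomial_fin k r
  refine ⟨CycleMod.subsingleton_higherChow_zero fun Z hZ => ?_, fun Z hZ => ?_⟩ <;>
    obtain ⟨g, hg⟩ := hZ.exists_asIdeal_eq (by omega)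
  · obtain ⟨W, -, hW⟩ := CycleMod.exists_admissible_boundary_eq hd hZ hg
    exact ⟨W, hW⟩
  · exact ⟨g, hg, CycleMod.exists_admissible_boundary_eq hd hZ hg⟩
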